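/- Let $r, q, n$ be positive integers with $q \mid r$. Let $G(r,1,n) = (\mathbb{Z}/r\mathbb{Z})^n \rtimes S_n$, where $S_n$ permutes the coordinates, and let $$G(r,q,n) = \Big\{ (z_1,\dots,z_n;\sigma) \in G(r,1,n) \;\Big|\; \sum_{i=1}^n z_i \equiv 0 \pmod q \Big\}.$$ If $n \ge 9$, then every irreducible complex representation of $G(r,q,n)$ whose dimension is not equal to $1$ has dimension at least $5$. -/

import Mathlib

/-- The generalized symmetric group `G(r,1,n) = (ℤ/r)ⁿ ⋊ Sₙ`, where a permutation `σ` acts on the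
tuple `z` by permuting its coordinates: `(σ • z) i = z (σ⁻¹ i)`. The group `ℤ/r` is written
multiplicatively because `SemidirectProduct` is a multiplicative construction. -/
abbrev GeneralizedSymmetricGroup (r n : ℕ) : Type :=
  (Fin n → Multiplicative (ZMod r)) ⋊[mulAutArrow] Equiv.Perm (Fin n)

/-- For `q ∣ r`, the subgroup `G(r,q,n)` of `G(r,1,n)` formed by those `(z₁, …, zₙ; σ)` for which
`z₁ + ⋯ + zₙ ≡ 0 (mod q)`. The congruence makes sense for elements of `ℤ/r` because `q ∣ r`: it
says that the sum is sent to `0` by the reduction map `ℤ/r → ℤ/q`. -/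
def complexReflectionGroup (r q n : ℕ) (hq : q ∣ r) : Subgroup (GeneralizedSymmetricGroup r n) where
  carrier := {g | ZMod.castHom hq (ZMod q) (∑ i, (g.left i).toAdd) = 0}
  one_mem' := by simp
  mul_mem' := by
    intro a b ha hb
    have h : ∑ i, (b.left (a.right⁻¹ i)).toAdd = ∑ i, (b.left i).toAdd :=
      Equiv.sum_comp a.right⁻¹ fun i => (b.left i).toAdd
    simp only [Set.mem_ofPred_eq] at ha hb ⊢
    have e : ∑ i, ((a * b).left i).toAdd
        = ∑ i, (a.left i).toAdd + ∑ i, (b.left (a.right⁻¹ i)).toAdd := by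
      rw [← Finset.sum_add_distrib]
      rfl
    rw [e, h, map_add, ha, hb, add_zero]
  inv_mem' := by
    intro a ha
    simp only [Set.mem_ofPred_eq] at ha ⊢
    have h : ∑ i, (a.left (a.right i)).toAdd = ∑ i, (a.left i).toAdd :=
      Equiv.sum_comp a.right fun i => (a.left i).toAdd
    have e : ∑ i, (a⁻¹.left i).toAdd = -∑ i, (a.left (a.right i)).toAdd := by
      rw [← Finset.sum_neg_distrib]
      refine Finset.sum_congr rfl fun i _ => ?_
      change ((a.left⁻¹) ((a.right⁻¹)⁻¹ • i)).toAdd = _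
      simp
    rw [e, h, map_neg, ha, neg_zero]

/-!
A representation of dimension at most `4` of `G(r,q,n)`, with `n ≥ 9`, has commutative image, so
that an irreducible one is a line by Schur's lemma.

Three disjoint `3`-cycles generate a subgroup `(ℤ/3)³` of `Sₙ`, which acts diagonalizably. Its
normalizer permutes the three coordinates of a weight in `(ℤ/3)³` cyclically and changes their signs
arbitrarily, and the orbit of a nonzero weight has at least `6` elements. Weight spaces are
independent, so in dimension at most `4` only the weight `0` occurs: `3`-cycles act trivially
(`map_fiberRotation_eq_one`, `map_eq_one_of_isThreeCycle`).

A normal subgroup of `G(r,q,n)` that contains the `3`-cycles contains the alternating group and,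
through the commutators of `3`-cycles with the tuples `eᵢ - eₖ`, all tuples of sum zero. Together
these form the kernel of the map `(z; σ) ↦ (∑ zᵢ, sign σ)` to a commutative group
(`GeneralizedSymmetricGroup.ker_sumSign_le`), hence all commutators act trivially.
-/

/-! ### Irreducible representations of finite groups and Schur's lemma -/

namespace Representation

theorem IsIrreducible.nontrivial_space {k G V : Type*} [Field k] [Group G]
    [AddCommGroup V] [Module k V] {ρ : Representation k G V} (h : ρ.IsIrreducible) :
    Nontrivial V := by
  have := h
  by_contra h0
  rw [not_nontrivial_iff_subsingleton] at h0
  apply bot_ne_top (α := Subrepresentation ρ)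
  apply Subrepresentation.toSubmodule_injective
  exact Subsingleton.elim _ _

theorem IsIrreducible.finiteDimensional_of_finite {k G V : Type*} [Field k] [Group G] [Finite G]
    [AddCommGroup V] [Module k V] {ρ : Representation k G V} (h : ρ.IsIrreducible) :
    FiniteDimensional k V := by
  have := h
  have := h.nontrivial_space
  obtain ⟨v, hv⟩ := exists_ne (0 : V)
  let W : Subrepresentation ρ :=
    { toSubmodule := Submodule.span k (Set.range fun g => ρ g v)
      apply_mem_toSubmodule := fun g w hw => by
        have : Submodule.span k (Set.range fun g => ρ g v) ≤
            (Submodule.span k (Set.range fun g => ρ g v)).comap (ρ g) := by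
          rw [Submodule.span_le]
          rintro _ ⟨g', rfl⟩
          exact Submodule.subset_span ⟨g * g', by simp⟩
        exact this hw }
  have hvW : v ∈ W.toSubmodule := Submodule.subset_span ⟨1, by simp⟩
  rcases eq_bot_or_eq_top W with hW | hW
  · rw [hW] at hvW
    exact absurd ((Submodule.mem_bot k).1 hvW) hv
  · have hW' : Submodule.span k (Set.range fun g => ρ g v) = ⊤ :=
      congrArg Subrepresentation.toSubmodule hW
    exact ⟨hW' ▸ Submodule.fg_span (Set.finite_range _)⟩

/-- Only the image has to be commutative, as opposed to the acting group itself in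
`Representation.IsIrreducible.finrank_eq_one_of_isMulCommutative`. -/
theorem IsIrreducible.finrank_eq_one_of_commute {k G V : Type*} [Field k] [IsAlgClosed k] [Group G]
    [AddCommGroup V] [Module k V] [FiniteDimensional k V] {ρ : Representation k G V}
    (h : ρ.IsIrreducible) (hc : ∀ g g', Commute (ρ g) (ρ g')) : Module.finrank k V = 1 := by
  have := h
  have := h.nontrivial_space
  obtain ⟨v, hv⟩ := exists_ne (0 : V)
  -- Eigenspaces of `ρ g` are invariant under the whole image, so `ρ g` is a scalar.
  have hs : ∀ g, ∃ a : k, ∀ w, ρ g w = a • w := by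
    intro g
    obtain ⟨a, ha⟩ := Module.End.exists_eigenvalue (ρ g)
    refine ⟨a, ?_⟩
    let W : Subrepresentation ρ :=
      { toSubmodule := Module.End.eigenspace (ρ g) a
        apply_mem_toSubmodule := fun g' w hw => by
          rw [Module.End.mem_eigenspace_iff] at hw ⊢
          rw [← Module.End.mul_apply, (hc g g').eq, Module.End.mul_apply, hw, map_smul] }
    rcases eq_bot_or_eq_top W with hW | hW
    · exact absurd (congrArg Subrepresentation.toSubmodule hW) ha
    · intro w
      have hw : w ∈ W.toSubmodule := by rw [hW]; exact Submodule.mem_top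
      exact Module.End.mem_eigenspace_iff.1 hw
  let W : Subrepresentation ρ :=
    { toSubmodule := Submodule.span k {v}
      apply_mem_toSubmodule := fun g w hw => by
        obtain ⟨a, ha⟩ := hs g
        rw [ha]
        exact Submodule.smul_mem _ _ hw }
  have hvW : v ∈ W.toSubmodule := Submodule.mem_span_singleton_self v
  rcases eq_bot_or_eq_top W with hW | hW
  · rw [hW] at hvW
    exact absurd ((Submodule.mem_bot k).1 hvW) hv
  · have hW' : Submodule.span k {v} = ⊤ := congrArg Subrepresentation.toSubmodule hW
    rw [finrank_eq_one_iff_of_nonzero v hv]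
    exact hW'

end Representation

/-! ### Three commuting `3`-cycles on nine points -/

/-- The `3`-cycle of the nine points `Fin 3 × ZMod 3` that rotates the `i`-th fibre of the first
projection. -/
def fiberRotation (i : Fin 3) : Equiv.Perm (Fin 3 × ZMod 3) :=
  Equiv.Perm.prodExtendRight i (Equiv.addRight 1)

/-- The permutation of `Fin 3 × ZMod 3` that shifts the fibres of the first projection cyclically
by `k`, after negating those fibres `i` for which `s i` holds. -/
def signedShift (s : Fin 3 → Bool) (k : Fin 3) : Equiv.Perm (Fin 3 × ZMod 3) where
  toFun p := (p.1 + k, cond (s p.1) (-p.2) p.2)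
  invFun p := (p.1 - k, cond (s (p.1 - k)) (-p.2) p.2)
  left_inv p := by cases h : s p.1 <;> simp [h]
  right_inv p := by cases h : s (p.1 - k) <;> simp [h]

theorem fiberRotation_pow_three (i : Fin 3) : fiberRotation i ^ 3 = 1 := by
  revert i; decide

theorem fiberRotation_commute (i j : Fin 3) : Commute (fiberRotation i) (fiberRotation j) := by
  unfold Commute SemiconjBy
  revert i j; decide

theorem fiberRotation_isThreeCycle (i : Fin 3) : (fiberRotation i).IsThreeCycle := by
  rw [← card_support_eq_three_iff]
  revert i; decide

theorem fiberRotation_mul_signedShift (s : Fin 3 → Bool) (k i : Fin 3) :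
    fiberRotation (i + k) * signedShift s k =
      signedShift s k * fiberRotation i ^ (cond (s i) 2 1) := by
  revert s k i; decide +kernel

/-- The action of `signedShift s k` on the weights of the three commuting fibre rotations. -/
def shiftWeight (s : Fin 3 → Bool) (k : Fin 3) (x : Fin 3 → ZMod 3) : Fin 3 → ZMod 3 :=
  fun j => cond (s (j - k)) (-x (j - k)) (x (j - k))

theorem five_le_card_shiftWeight {x : Fin 3 → ZMod 3} (hx : x ≠ 0) :
    5 ≤ (Finset.univ.image
      fun p : (Fin 3 → Bool) × Fin 3 => shiftWeight p.1 p.2 x).card := by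
  revert x; decide +kernel

/-! ### Weight spaces of commuting endomorphisms of order three -/

/-- The weight space of a family `f` of endomorphisms of a complex vector space: the joint
eigenspace on which each `f i` acts by the cube root of unity `exp (2πi x i / 3)`. -/
noncomputable def cubicWeightSpace {ι V : Type*} [AddCommGroup V] [Module ℂ V]
    (f : ι → Module.End ℂ V) (x : ι → ZMod 3) : Submodule ℂ V :=
  ⨅ i, (f i).eigenspace (ZMod.stdAddChar (x i))

section cubicWeightSpace

variable {ι V : Type*} [AddCommGroup V] [Module ℂ V]
  {f : ι → Module.End ℂ V}

theorem mem_cubicWeightSpace {x : ι → ZMod 3} {v : V} :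
    v ∈ cubicWeightSpace f x ↔ ∀ i, f i v = ZMod.stdAddChar (x i) • v := by
  simp [cubicWeightSpace, Submodule.mem_iInf]

theorem isSemisimple_of_pow_three_eq_one {g : Module.End ℂ V} (hg : g ^ 3 = 1) :
    g.IsSemisimple := by
  refine Module.End.isSemisimple_of_squarefree_aeval_eq_zero
    (p := Polynomial.X ^ 3 - Polynomial.C 1) ?_ (by simp [hg])
  exact (Polynomial.separable_X_pow_sub_C (1 : ℂ) (by norm_num) one_ne_zero).squarefree

theorem maxGenEigenspace_eq_eigenspace_of_pow_three_eq_one {g : Module.End ℂ V} (hg : g ^ 3 = 1)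
    (μ : ℂ) : g.maxGenEigenspace μ = g.eigenspace μ :=
  (isSemisimple_of_pow_three_eq_one hg).isFinitelySemisimple.maxGenEigenspace_eq_eigenspace μ

theorem iSupIndep_cubicWeightSpace (hc : ∀ i j, Commute (f i) (f j)) (h3 : ∀ i, f i ^ 3 = 1) :
    iSupIndep (cubicWeightSpace f) := by
  have h := Module.End.independent_iInf_maxGenEigenspace_of_forall_mapsTo f
    fun i j φ => Module.End.mapsTo_maxGenEigenspace_of_comm (hc j i) φ
  have hinj : Function.Injective
      fun (x : ι → ZMod 3) (i : ι) => (ZMod.stdAddChar (x i) : ℂ) := fun x y hxy =>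
    funext fun i => ZMod.injective_stdAddChar (congrFun hxy i)
  convert h.comp hinj using 1
  ext1 x
  simp [cubicWeightSpace, maxGenEigenspace_eq_eigenspace_of_pow_three_eq_one (h3 _)]

theorem iSup_cubicWeightSpace [FiniteDimensional ℂ V]
    (hc : ∀ i j, Commute (f i) (f j)) (h3 : ∀ i, f i ^ 3 = 1) :
    ⨆ x, cubicWeightSpace f x = ⊤ := by
  have h := Module.End.iSup_iInf_maxGenEigenspace_eq_top_of_forall_mapsTo f
    (fun i j φ => Module.End.mapsTo_maxGenEigenspace_of_comm (hc j i) φ)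
    (fun i => Module.End.iSup_maxGenEigenspace_eq_top (f i))
  simp only [maxGenEigenspace_eq_eigenspace_of_pow_three_eq_one (h3 _)] at h
  rw [eq_top_iff, ← h, iSup_le_iff]
  intro χ v hv
  rw [Submodule.mem_iInf] at hv
  rcases eq_or_ne v 0 with rfl | hv0
  · exact zero_mem _
  have hζ : IsPrimitiveRoot (ZMod.stdAddChar (1 : ZMod 3)) 3 := by
    refine IsPrimitiveRoot.iff_def _ _ |>.2 ⟨?_, fun l hl => ?_⟩
    · rw [← AddChar.map_nsmul_eq_pow, show 3 • (1 : ZMod 3) = 0 from rfl, AddChar.map_zero_eq_one]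
    · rw [← AddChar.map_nsmul_eq_pow, ← AddChar.map_zero_eq_one (ZMod.stdAddChar (N := 3))] at hl
      have := ZMod.injective_stdAddChar hl
      rw [nsmul_eq_mul, mul_one] at this
      exact (ZMod.natCast_eq_zero_iff l 3).1 this
  have hχ : ∀ i, ∃ a : ZMod 3, ZMod.stdAddChar a = χ i := by
    intro i
    have hi := Module.End.mem_eigenspace_iff.1 (hv i)
    have h1 : χ i ^ 3 = 1 := by
      have : (f i ^ 3) v = χ i ^ 3 • v := by
        simp [pow_succ, hi, mul_smul]
      rw [h3, Module.End.one_apply] at this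
      exact smul_left_injective ℂ hv0 (by simpa using this.symm)
    obtain ⟨l, -, hl⟩ := hζ.eq_pow_of_pow_eq_one h1
    exact ⟨l • 1, by rw [AddChar.map_nsmul_eq_pow, hl]⟩
  choose x hx using hχ
  refine Submodule.mem_iSup_of_mem x (mem_cubicWeightSpace.2 fun i => ?_)
  rw [hx]
  exact Module.End.mem_eigenspace_iff.1 (hv i)

end cubicWeightSpace

/-! ### Three-cycles act trivially in small dimension -/

/-- The weights of the three commuting fibre rotations are permuted by the signed shifts, and a
nonzero weight has at least five images, too many for a space of dimension at most four. -/
theorem map_fiberRotation_eq_one {V : Type*} [AddCommGroup V] [Module ℂ V] [FiniteDimensional ℂ V]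
    (φ : Equiv.Perm (Fin 3 × ZMod 3) →* Module.End ℂ V) (hV : Module.finrank ℂ V < 5)
    (i : Fin 3) : φ (fiberRotation i) = 1 := by
  let f : Fin 3 → Module.End ℂ V := fun i => φ (fiberRotation i)
  have hc : ∀ i j, Commute (f i) (f j) := fun i j => (fiberRotation_commute i j).map φ
  have h3 : ∀ i, f i ^ 3 = 1 := fun i => by
    simp only [f, ← map_pow, fiberRotation_pow_three, map_one]
  have hind := iSupIndep_cubicWeightSpace hc h3
  have hmove : ∀ x s k v, v ∈ cubicWeightSpace f x →
      φ (signedShift s k) v ∈ cubicWeightSpace f (shiftWeight s k x) := by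
    intro x s k v hv
    rw [mem_cubicWeightSpace] at hv ⊢
    intro j
    obtain ⟨i, rfl⟩ : ∃ i, j = i + k := ⟨j - k, by simp⟩
    change (φ (fiberRotation (i + k)) * φ (signedShift s k)) v = _
    rw [← map_mul, fiberRotation_mul_signedShift, map_mul, Module.End.mul_apply, map_pow,
      ← map_smul]
    have hi : φ (fiberRotation i) v = _ := hv i
    cases h : s i
    · simp [shiftWeight, h, hi]
    -- Negating the fibre inverts the rotation, and the inverse of an element of order three is its
    -- square.
    · have h2 : -x i = x i + x i := by generalize x i = a; revert a; decide
      simp only [shiftWeight, add_sub_cancel_right, h, cond_true, pow_two, Module.End.mul_apply, hi,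
        map_smul, h2, AddChar.map_add_eq_mul, mul_smul]
  have hzero : ∀ x, x ≠ 0 → cubicWeightSpace f x = ⊥ := by
    intro x hx
    by_contra hne
    have := hind.fintypeNeBotOfFiniteDimensional
    refine hV.not_ge (le_trans ?_ hind.subtype_ne_bot_le_finrank)
    rw [Fintype.card_subtype]
    refine (five_le_card_shiftWeight hx).trans (Finset.card_le_card ?_)
    rw [Finset.image_subset_iff]
    rintro ⟨s, k⟩ -
    rw [Finset.mem_filter]
    refine ⟨Finset.mem_univ _, ?_⟩
    obtain ⟨v, hv, hv0⟩ := Submodule.exists_mem_ne_zero_of_ne_bot hne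
    refine Submodule.ne_bot_iff _ |>.2 ⟨_, hmove x s k v hv, fun h => hv0 ?_⟩
    have h1 : (φ (signedShift s k)⁻¹ * φ (signedShift s k)) v = 0 := by
      rw [Module.End.mul_apply, h, map_zero]
    rwa [← map_mul, inv_mul_cancel, map_one] at h1
  have htop : cubicWeightSpace f 0 = ⊤ := by
    rw [eq_top_iff, ← iSup_cubicWeightSpace hc h3, iSup_le_iff]
    intro x
    rcases eq_or_ne x 0 with rfl | hx
    · exact le_rfl
    · rw [hzero x hx]; exact bot_le
  ext v
  have hv : v ∈ cubicWeightSpace f 0 := htop ▸ Submodule.mem_top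
  simpa using mem_cubicWeightSpace.1 hv i

theorem map_eq_one_of_isThreeCycle {α V : Type*} [Fintype α] [DecidableEq α] [AddCommGroup V]
    [Module ℂ V] [FiniteDimensional ℂ V] (hα : 9 ≤ Fintype.card α)
    (φ : Equiv.Perm α →* Module.End ℂ V)
    (hV : Module.finrank ℂ V < 5) {c : Equiv.Perm α} (hc : c.IsThreeCycle) : φ c = 1 := by
  obtain ⟨ι⟩ : Nonempty (Fin 3 × ZMod 3 ↪ α) :=
    Function.Embedding.nonempty_of_card_le (by simpa [ZMod.card] using hα)
  have h1 := map_fiberRotation_eq_one (φ.comp (Equiv.Perm.viaEmbeddingHom ι)) hV 0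
  set d := Equiv.Perm.viaEmbeddingHom ι (fiberRotation 0) with hd
  have hd1 : φ d = 1 := h1
  have hconj : IsConj d c := by
    rw [Equiv.Perm.isConj_iff_cycleType_eq, hc.cycleType, hd, Equiv.Perm.viaEmbeddingHom_apply,
      Equiv.Perm.viaEmbedding]
    classical
    convert (fiberRotation_isThreeCycle 0).cycleType using 1
    convert Equiv.Perm.cycleType_extendDomain (Equiv.ofInjective ι.1 ι.2)
  obtain ⟨g, rfl⟩ := isConj_iff.1 hconj
  rw [map_mul, map_mul, hd1, mul_one, ← map_mul, mul_inv_cancel, map_one]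

/-! ### The normal closure of the three-cycles -/

namespace GeneralizedSymmetricGroup

open SemidirectProduct

theorem inr_mem_complexReflectionGroup {r q n : ℕ} (hq : q ∣ r) (σ : Equiv.Perm (Fin n)) :
    (inr σ : GeneralizedSymmetricGroup r n) ∈ complexReflectionGroup r q n hq := by
  simp [complexReflectionGroup]

theorem inl_mem_complexReflectionGroup {r q n : ℕ} (hq : q ∣ r)
    {z : Fin n → Multiplicative (ZMod r)} (hz : ∏ i, z i = 1) :
    (inl z : GeneralizedSymmetricGroup r n) ∈ complexReflectionGroup r q n hq := by
  have : ∑ i, (z i).toAdd = 0 := by rw [← toAdd_prod, hz, toAdd_one]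
  change ZMod.castHom hq (ZMod q) (∑ i, (z i).toAdd) = 0
  rw [this, map_zero]

theorem mulAutArrow_mulSingle {M α : Type*} [CommGroup M] [DecidableEq α] (σ : Equiv.Perm α)
    (i : α) (a : M) :
    mulAutArrow σ (Pi.mulSingle (M := fun _ => M) i a) =
      Pi.mulSingle (M := fun _ => M) (σ i) a := by
  ext m
  change Pi.mulSingle (M := fun _ => M) i a (σ⁻¹ m) = _
  simp only [Pi.mulSingle_apply, Equiv.Perm.inv_eq_iff_eq]

/-- The homomorphism `(z; σ) ↦ (z₁ + ⋯ + zₙ, sign σ)` to a commutative group. -/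
def sumSign (r n : ℕ) : GeneralizedSymmetricGroup r n →* Multiplicative (ZMod r) × ℤˣ where
  toFun g := (∏ i, g.left i, Equiv.Perm.sign g.right)
  map_one' := by simp
  map_mul' a b := by
    have h : ∏ i, b.left (a.right⁻¹ i) = ∏ i, b.left i :=
      Equiv.prod_comp a.right⁻¹ fun i => b.left i
    have e : ∏ i, (a * b).left i = (∏ i, a.left i) * ∏ i, b.left (a.right⁻¹ i) := by
      rw [← Finset.prod_mul_distrib]
      rfl
    rw [e, h]
    simp

/-- The `3`-cycles normally generate the kernel of `sumSign`, even under conjugation by `G(r,q,n)`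
alone: commutators with them yield the differences of two coordinate vectors, which span the tuples
of sum zero. -/
theorem ker_sumSign_le {r q n : ℕ} (hq : q ∣ r) (hn : 4 ≤ n)
    (K : Subgroup (GeneralizedSymmetricGroup r n))
    (hconj : ∀ g ∈ complexReflectionGroup r q n hq, ∀ x ∈ K, g * x * g⁻¹ ∈ K)
    (hcycle : ∀ c : Equiv.Perm (Fin n), c.IsThreeCycle → inr c ∈ K) :
    (sumSign r n).ker ≤ K := by
  have halt : ∀ σ : Equiv.Perm (Fin n), Equiv.Perm.sign σ = 1 → inr σ ∈ K := by
    have : alternatingGroup (Fin n) ≤ K.comap inr := by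
      rw [← Equiv.Perm.closure_three_cycles_eq_alternating, Subgroup.closure_le]
      exact hcycle
    exact fun σ hσ => this (Equiv.Perm.mem_alternatingGroup.2 hσ)
  have hdiff : ∀ (i j : Fin n) (a : Multiplicative (ZMod r)),
      inl (Pi.mulSingle i a / Pi.mulSingle j a) ∈ K := by
    intro i j a
    rcases eq_or_ne i j with rfl | hij
    · simp [K.one_mem]
    have hcard : ({i, j} : Finset (Fin n)).card ≤ 2 := Finset.card_le_two
    obtain ⟨k, hk⟩ : ∃ k, k ∉ ({i, j} : Finset (Fin n)) := by
      by_contra! h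
      have := Finset.card_le_card (fun x _ => h x : Finset.univ ⊆ _)
      simp at this; omega
    obtain ⟨l, hl⟩ : ∃ l, l ∉ ({i, j, k} : Finset (Fin n)) := by
      by_contra! h
      have := Finset.card_le_card (fun x _ => h x : Finset.univ ⊆ _)
      have h3 : ({i, j, k} : Finset (Fin n)).card ≤ 3 := Finset.card_le_three
      simp at this; omega
    simp only [Finset.mem_insert, Finset.mem_singleton, not_or] at hk hl
    -- The cycle `c` sends `i` to `j` and fixes `k`, so it moves `eᵢ - eₖ` to `eⱼ - eₖ`.
    let c : Equiv.Perm (Fin n) := Equiv.swap i l * Equiv.swap i j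
    have hc : inr c ∈ K := hcycle c
      (Equiv.Perm.isThreeCycle_swap_mul_swap_same (Ne.symm hl.1) hij hl.2.1)
    have hci : c i = j := by
      simp [c, Equiv.swap_apply_of_ne_of_ne hij.symm (Ne.symm hl.2.1)]
    have hck : c k = k := by
      simp [c, Equiv.swap_apply_of_ne_of_ne hk.1 hk.2,
        Equiv.swap_apply_of_ne_of_ne hk.1 (Ne.symm hl.2.2)]
    let w : Fin n → Multiplicative (ZMod r) := Pi.mulSingle i a / Pi.mulSingle k a
    have hw : (inl w : GeneralizedSymmetricGroup r n) ∈ complexReflectionGroup r q n hq :=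
      inl_mem_complexReflectionGroup hq (by simp [w, Finset.prod_div_distrib])
    have hcw : mulAutArrow c w = Pi.mulSingle j a / Pi.mulSingle k a := by
      simp only [w]
      rw [map_div, mulAutArrow_mulSingle, mulAutArrow_mulSingle, hci, hck]
    have hmem := K.mul_mem (hconj _ hw _ hc) (K.inv_mem hc)
    have heq : (Pi.mulSingle i a / Pi.mulSingle j a : Fin n → Multiplicative (ZMod r)) =
        w * (mulAutArrow c w)⁻¹ := by
      rw [hcw, ← div_eq_mul_inv, div_div_div_cancel_right]
    rw [heq, map_mul, map_inv, inl_aut]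
    simpa only [mul_assoc, mul_inv_rev, map_inv, inv_inv] using hmem
  intro g hg
  obtain ⟨h1, h2⟩ : ∏ i, g.left i = 1 ∧ Equiv.Perm.sign g.right = 1 := by
    simpa [sumSign, MonoidHom.mem_ker] using hg
  rw [← inl_left_mul_inr_right g]
  refine K.mul_mem ?_ (halt _ h2)
  let o : Fin n := ⟨0, by omega⟩
  have hz : g.left = ∏ i, (Pi.mulSingle i (g.left i) / Pi.mulSingle o (g.left i)) := by
    rw [Finset.prod_div_distrib, Finset.univ_prod_mulSingle]
    have : ∏ i, Pi.mulSingle o (g.left i) = (1 : Fin n → Multiplicative (ZMod r)) := by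
      rw [← Pi.mulSingle_one o, ← h1]
      exact (map_prod (MonoidHom.mulSingle (fun _ : Fin n => Multiplicative (ZMod r)) o) _ _).symm
    rw [this, div_one]
  rw [hz]
  exact Subgroup.prod_mem (K.comap inl) fun i _ => hdiff i o _

end GeneralizedSymmetricGroup

/-! ### Small irreducible representations -/

open GeneralizedSymmetricGroup in
theorem corollary1p8 (r q n : ℕ) (hr : 0 < r) (hq : q ∣ r) (hn : 9 ≤ n)
    {V : Type*} [AddCommGroup V] [Module ℂ V]
    (ρ : Representation ℂ (complexReflectionGroup r q n hq) V)
    (hirr : ρ.IsIrreducible) (hlin : Module.finrank ℂ V ≠ 1) :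
    5 ≤ Module.finrank ℂ V := by
  have : NeZero r := ⟨hr.ne'⟩
  have : Finite (GeneralizedSymmetricGroup r n) :=
    Finite.of_equiv _ SemidirectProduct.equivProd.symm
  have := hirr.finiteDimensional_of_finite
  by_contra! hV
  refine hlin (hirr.finrank_eq_one_of_commute fun g g' => ?_)
  let ι : Equiv.Perm (Fin n) →* complexReflectionGroup r q n hq :=
    SemidirectProduct.inr.codRestrict _ (inr_mem_complexReflectionGroup hq)
  let S := (complexReflectionGroup r q n hq).subtype
  have hker : (sumSign r n).ker ≤ (MonoidHom.ker ρ).map S := by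
    refine ker_sumSign_le hq (by omega) _ ?_ fun c hc =>
      ⟨ι c, map_eq_one_of_isThreeCycle (by simpa using hn) (ρ.comp ι) hV hc, rfl⟩
    rintro g hg _ ⟨x, hx, rfl⟩
    refine ⟨⟨g, hg⟩ * x * ⟨g, hg⟩⁻¹, ?_, rfl⟩
    change ρ _ = 1
    rw [map_mul, map_mul, show ρ x = 1 from hx, mul_one, ← map_mul, mul_inv_cancel, map_one]
  -- Commutators lie in the kernel of `sumSign`, so `ρ` kills them.
  obtain ⟨x, hx, hxg⟩ := hker (show S (g * g' * g⁻¹ * g'⁻¹) ∈ _ by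
    rw [MonoidHom.mem_ker]
    simp only [map_mul, map_inv]
    rw [mul_right_comm _ (sumSign r n (S g')), mul_inv_cancel, one_mul, mul_inv_cancel])
  obtain rfl : x = g * g' * g⁻¹ * g'⁻¹ := Subtype.ext hxg
  have h1 : ρ (g * g' * g⁻¹ * g'⁻¹ * (g' * g)) = ρ (g' * g) := by
    rw [map_mul, show ρ (g * g' * g⁻¹ * g'⁻¹) = 1 from hx, one_mul]
  simpa [Commute, SemiconjBy, mul_assoc] using h1
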